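/- Let $d\ge 2$ and $m\ge 1$ be integers, let $c$ be an indeterminate and $f_c(z)=z^d+c\in\mathbb Z[c][z]$. Write $f_c^{\circ k}$ for the $k$-th iterate of $f_c$, $\mu$ for the Möbius function, and $d_m=\sum_{k\mid m}d^k\mu(m/k)$. Let $\Phi_m^*(z)=\prod_{k\mid m}\bigl(f_c^{\circ k}(z)-z\bigr)^{\mu(m/k)}\in\mathbb Z[c][z]$ be the $m$-th dynatomic polynomial, and let $\delta_m(x)$ be the $m$-th multiplier polynomial of $f_c$, i.e. the polynomial over an algebraic closure $\overline{\mathbb Q(c)}$ of $\mathbb Q(c)$, monic in $x$, determined by $$\delta_m(x)^m=\prod_{\Phi_m^*(\alpha)=0}\bigl(x-(f_c^{\circ m})'(\alpha)\bigr),$$ where $\alpha$ runs over the roots of $\Phi_m^*$ in $\overline{\mathbb Q(c)}$ with multiplicity. Then $\Phi_m^*$ is indeed a polynomial, $\delta_m$ exists and is unique, $m$ divides $d_m$, and $\delta_m(x)\in\mathbb Z[d^dc^{d-1},x]$. More precisely, there is a polynomial $\Psi(x,t)\in\mathbb Z[x,t]$ with $\delta_m(x)=\Psi(x,d^dc^{d-1})$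 such that $(-1)^{\frac{d_m}{m}+d_m(d-1)}\,\Psi(x,t)$, viewed as a polynomial in $t$ with coefficients in $\mathbb Z[x]$, is monic (its leading coefficient is the constant $1$). -/

import Mathlib

open Polynomial

namespace Dynatomic

variable {O : Type*} [CommRing O]

/-- The `k`-th iterated composition `f ∘ f ∘ ⋯ ∘ f` as a polynomial (with `f^{∘ 0} = z`). -/
noncomputable def iter (f : O[X]) (k : ℕ) : O[X] := f.comp^[k] X

/-- The integer `d_n = ∑_{k ∣ n} d ^ k μ(n / k)`. -/
def formalDegree (d n : ℕ) : ℤ :=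
  ∑ k ∈ n.divisors, (d : ℤ) ^ k * ArithmeticFunction.moebius (n / k)

/-- `Φ ∈ O[z]` is the `n`-th dynatomic polynomial of `f`: in the field of fractions of `O[z]` one has
`Φ = ∏_{k ∣ n} (f^{∘ k}(z) - z) ^ μ(n / k)`. There is at most one such `Φ`. -/
def IsDynatomicPolynomial [IsDomain O] (f : O[X]) (n : ℕ) (Φ : O[X]) : Prop :=
  algebraMap O[X] (FractionRing O[X]) Φ =
    ∏ k ∈ n.divisors,
      algebraMap O[X] (FractionRing O[X]) (iter f k - X) ^ (ArithmeticFunction.moebius (n / k))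

/-- The multiplier `ω_n(α) = (f^{∘ n})'(α)` of a point `α` of an `O`-algebra. -/
noncomputable def multiplier {L : Type*} [CommRing L] [Algebra O L] (f : O[X]) (n : ℕ) (α : L) : L :=
  aeval α (derivative (iter f n))

/-- An algebraic closure of the field of fractions of `O`. -/
abbrev GeomField (O : Type*) [CommRing O] [IsDomain O] : Type _ :=
  AlgebraicClosure (FractionRing O)

/-- `δ` is the `n`-th multiplier polynomial of `f` (for `n ≥ 1`): the polynomial, monic in `x`, with
`δ(x) ^ n = ∏_{Φ(α) = 0} (x - ω_n(α))`, where `Φ` is the `n`-th dynatomic polynomial of `f` and `α`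
runs through its roots in an algebraic closure of `Frac O`, counted with multiplicity. -/
def IsMultiplierPolynomial [IsDomain O] (f : O[X]) (n : ℕ) (δ : (GeomField O)[X]) : Prop :=
  ∃ Φ : O[X], IsDynatomicPolynomial f n Φ ∧ δ.Monic ∧
    δ ^ n = ((Φ.aroots (GeomField O)).map fun α => X - C (multiplier f n α)).prod

/-- The family `f_c(z) = z ^ d + c`, as a polynomial in `z` over `ℤ[c]`, where `c` is an
indeterminate (the inner variable). -/
noncomputable def unicritical (d : ℕ) : ℤ[X][X] := X ^ d + C X

/-- For `Ψ(t) ∈ ℤ[x][t]` (inner variable `x`, outer variable `t`) and an element `a` of a commutative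
ring `L`, the polynomial `Ψ(a) ∈ L[x]`: substitute `a` for `t` and keep `x`. -/
noncomputable def substOuter {L : Type*} [CommRing L] (Ψ : ℤ[X][X]) (a : L) : L[X] :=
  Ψ.eval₂ (mapRingHom (Int.castRingHom L)) (C a)

end Dynatomic

namespace Dynatomic

/-! Existence rests on cycles. A point `z` of period `k` is integral over `ℤ[c]`, and its multiplier
is `d` times an integral element, hence not `1`. So `f^k(z) - z` has simple roots, and the dynatomic
polynomial has as roots exactly the points of exact period `m`. The multiplier is constant on each
`m`-cycle, so taking one factor per cycle gives the `m`-th root `multiplierPoly`.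

Put `t = d^d c^(d-1)`. With `μ^(d-1) = d`, the rescaled orbit `u = μz` satisfies `u_i^d = d u_(i+1)
- μ^d c`, where `(μ^d c)^(d-1) = t`. Hence the `u_i`, the multipliers `∏ u_i^(d-1)` and the
coefficients of `δ` are integral over `ℤ[t]`. An automorphism fixing `t` multiplies `c` by a
`(d-1)`-th root of unity, and conjugating by a rotation shows that it only permutes the cycles.
Since `ℤ[t]` is integrally closed, the coefficients lie in it
(`exists_aeval_eq_coeff_multiplierPoly`).

For the leading term, rescale at infinity. With `y^d = μ^d c` and `w = 1/y`, the orbit of `μwz` is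
integral over `ℤ[w]`, while `t = w^(-d(d-1))`. If `n` is the degree of `δ`, this bounds the
`t`-degree of the coefficient of `x^j` by `m(n-j)/d`. The constant coefficient attains `mn/d`,
because it is `±d^(mn) Φ(0)^(d-1)` with `Φ(0)` monic in `c` of degree `mn/d`. So it alone supplies
the leading term in `t`. -/

theorem monic_eq_of_pow_eq {K : Type*} [Field K] {p q : K[X]} (hp : p.Monic) (hq : q.Monic)
    {m : ℕ} (hm : m ≠ 0) (h : p ^ m = q ^ m) : p = q :=
  eq_of_monic_of_associated hp hq (associated_of_dvd_dvd
    ((IsIntegrallyClosed.pow_dvd_pow_iff hm).1 h.dvd) ((IsIntegrallyClosed.pow_dvd_pow_iff hm).1 h.symm.dvd))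

/-- Induction on the cardinality, removing one cycle at a time; `n` is the number of cycles. -/
theorem exists_card_eq_mul_and_prod_eq_pow {α M : Type*} [CommMonoid M] (F : α → α) (g : α → M)
    (w : M) {m : ℕ} (hm : 0 < m) (T : Finset α) (hT : ∀ x ∈ T, F x ∈ T)
    (hp : ∀ x ∈ T, Function.minimalPeriod F x = m)
    (hw : ∀ x ∈ T, ∏ i ∈ Finset.range m, g (F^[i] x) = w) :
    ∃ n, T.card = m * n ∧ ∏ x ∈ T, g x = w ^ n := by
  classical
  induction hn : T.card using Nat.strong_induction_on generalizing T with
  | _ n ih =>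
    subst hn
    rcases T.eq_empty_or_nonempty with rfl | ⟨a, ha⟩
    · exact ⟨0, by simp⟩
    have hit : ∀ k, F^[k] a ∈ T := fun k => by
      induction k with
      | zero => exact ha
      | succ k ih => rw [Function.iterate_succ_apply']; exact hT _ ih
    have hinj : Set.InjOn (fun k => F^[k] a) (Finset.range m : Set ℕ) := by
      intro i hi j hj hij
      simp only [Finset.coe_range, Set.mem_Iio] at hi hj
      exact (Function.iterate_injOn_Iio_minimalPeriod (f := F) (x := a))
        (by simpa [hp a ha] using hi) (by simpa [hp a ha] using hj) hij
    set O := (Finset.range m).image fun k => F^[k] a with hO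
    have hOc : O.card = m := by rw [hO, Finset.card_image_of_injOn hinj, Finset.card_range]
    have hOT : O ⊆ T := by
      intro x hx
      obtain ⟨k, -, rfl⟩ := Finset.mem_image.1 hx
      exact hit k
    have hmem : ∀ k, F^[k] a ∈ O := fun k =>
      Finset.mem_image.2 ⟨k % m, Finset.mem_range.2 (Nat.mod_lt _ hm), by
        simpa [hp a ha] using Function.iterate_mod_minimalPeriod_eq (f := F) (x := a) (n := k)⟩
    -- The complement of the cycle stays stable: `x` is recovered from `F x` by `m - 1` further
    -- steps.
    have hback : ∀ x ∈ T, F x ∈ O → x ∈ O := by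
      intro x hx hFx
      obtain ⟨k, -, hk⟩ := Finset.mem_image.1 hFx
      have : F^[m] x = x := by
        simpa [hp x hx] using Function.iterate_minimalPeriod (f := F) (x := x)
      obtain ⟨l, rfl⟩ := Nat.exists_eq_succ_of_ne_zero hm.ne'
      rw [Function.iterate_succ_apply, ← hk] at this
      simp only [← Function.iterate_add_apply] at this
      rw [← this]
      exact hmem _
    have hlt : (T \ O).card < T.card := by
      rw [Finset.card_sdiff_of_subset hOT, hOc]
      have := Finset.card_pos.2 ⟨a, ha⟩
      omega
    obtain ⟨n, hn, hprod⟩ := ih _ hlt (T \ O)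
      (fun x hx => Finset.mem_sdiff.2 ⟨hT x (Finset.mem_sdiff.1 hx).1,
        fun h => (Finset.mem_sdiff.1 hx).2 (hback x (Finset.mem_sdiff.1 hx).1 h)⟩)
      (fun x hx => hp x (Finset.mem_sdiff.1 hx).1) (fun x hx => hw x (Finset.mem_sdiff.1 hx).1) rfl
    refine ⟨n + 1, ?_, ?_⟩
    · rw [← Finset.card_sdiff_add_card_eq_card hOT, hOc, hn, mul_add, mul_one]
    · rw [← Finset.prod_sdiff hOT, hprod, hO, Finset.prod_image hinj, hw a ha, pow_succ]

/-- Up to sign, the coefficient is the elementary symmetric function of degree `s.card - j` in the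
roots, so `b` to that power clears the denominators of every term. -/
theorem coeff_prod_X_sub_C_mul_pow_mem {R : Type*} [CommRing R] (B : Subring R) (b : R)
    (s : Multiset R) (hs : ∀ a ∈ s, a * b ∈ B) (j : ℕ) :
    (s.map fun a => X - C a).prod.coeff j * b ^ (s.card - j) ∈ B := by
  nontriviality R
  induction s using Multiset.induction_on generalizing j with
  | empty =>
    rcases j with _ | j <;> simp [coeff_one, B.one_mem, B.zero_mem]
  | cons a s ih =>
    have ih := ih fun x hx => hs x (Multiset.mem_cons_of_mem hx)
    have ha := hs a (Multiset.mem_cons_self a s)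
    rw [Multiset.map_cons, Multiset.prod_cons, Multiset.card_cons, sub_mul, coeff_sub]
    set p := (s.map fun a => X - C a).prod with hp
    have key : ∀ i, p.coeff i * b ^ (s.card + 1 - i) * a ∈ B := by
      intro i
      rcases le_or_gt i s.card with h | h
      · rw [Nat.sub_add_comm h, pow_succ]
        have := B.mul_mem (ih i) ha
        convert this using 1
        ring
      · have : p.natDegree = s.card := natDegree_multiset_prod_X_sub_C_eq_card s
        rw [coeff_eq_zero_of_natDegree_lt (by omega)]
        simp [B.zero_mem]
    rcases j with _ | j
    · have := B.neg_mem (key 0)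
      convert this using 1
      simp [mul_coeff_zero]
      ring
    · rw [coeff_X_mul, coeff_C_mul, sub_mul]
      have h1 := ih j
      rw [show s.card + 1 - (j + 1) = s.card - j by omega]
      refine B.sub_mem h1 ?_
      have := key (j + 1)
      rw [show s.card + 1 - (j + 1) = s.card - j by omega] at this
      convert this using 1
      ring

/-! ### Integrality and descent to a polynomial ring -/

/-- Repeated `d`-th powers give a monic `P` of degree `d^k` with `P(u 0) = e * u k`. Closing the
cycle at `k = m`, the polynomial `P - eX` is still monic because `d^m > 1`. -/
theorem isIntegral_of_pow_eq_mul_add {A L : Type*} [CommRing A] [Nontrivial A] [CommRing L]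
    [Algebra A L] {d m : ℕ} (hd : 2 ≤ d) (hm : m ≠ 0) (a b : A) (u : ℕ → L)
    (hu : ∀ i, u i ^ d = algebraMap A L a * u (i + 1) + algebraMap A L b) (hum : u m = u 0) :
    IsIntegral A (u 0) := by
  have key : ∀ k, ∃ (e : A) (P : A[X]), P.Monic ∧ P.natDegree = d ^ k ∧
      aeval (u 0) P = algebraMap A L e * u k := by
    intro k
    induction k with
    | zero => exact ⟨1, X, monic_X, by simp, by simp⟩
    | succ k ih =>
      obtain ⟨e, P, hP, hdeg, h⟩ := ih
      have hdeg' : (P ^ d).natDegree = d ^ (k + 1) := by rw [hP.natDegree_pow, hdeg, pow_succ']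
      have hlt : (C (e ^ d * b)).degree < (P ^ d).degree :=
        degree_C_le.trans_lt (natDegree_pos_iff_degree_pos.1 (by rw [hdeg']; positivity))
      refine ⟨e ^ d * a, P ^ d - C (e ^ d * b), (hP.pow d).sub_of_left hlt, ?_, ?_⟩
      · rw [natDegree_sub_C, hdeg']
      · simp only [map_sub, map_pow, aeval_C, h, mul_pow, hu, map_mul]
        ring
  obtain ⟨e, P, hP, hdeg, h⟩ := key m
  refine ⟨P - C e * X, hP.sub_of_left ?_, ?_⟩
  · refine (degree_C_mul_X_le e).trans_lt ?_
    rw [degree_eq_natDegree hP.ne_zero, hdeg]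
    exact_mod_cast lt_of_lt_of_le (by omega : 1 < d) (Nat.le_self_pow hm d)
  · rw [← aeval_def, map_sub, h, hum]
    simp

/-- `L` is an algebraic closure of `Frac A`, Galois in characteristic zero, so a fixed element lies
in `Frac A`; integral closedness puts it in `A`. -/
theorem mem_range_algebraMap_of_isIntegral_of_fixed {A L : Type*} [CommRing A] [IsDomain A]
    [IsIntegrallyClosed A] [CharZero A] [Field L] [IsAlgClosed L] [Algebra A L] [FaithfulSMul A L]
    [Algebra.IsAlgebraic A L] {x : L} (hx : IsIntegral A x) (h : ∀ σ : L ≃ₐ[A] L, σ x = x) :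
    x ∈ (algebraMap A L).range := by
  let := FractionRing.liftAlgebra A L
  have : IsScalarTower A (FractionRing A) L := FractionRing.isScalarTower_liftAlgebra A L
  have : Algebra.IsAlgebraic (FractionRing A) L := 
    (IsFractionRing.comap_isAlgebraic_iff (A := A)).1 inferInstance
  have : CharZero (FractionRing A) :=
    charZero_of_injective_algebraMap (IsFractionRing.injective A (FractionRing A))
  have : IsAlgClosure (FractionRing A) L := ⟨inferInstance, inferInstance⟩
  have : Normal (FractionRing A) L := IsAlgClosure.normal _ _
  have : IsGalois (FractionRing A) L := ⟨⟩
  have hb : x ∈ (⊥ : IntermediateField (FractionRing A) L) :=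
    (InfiniteGalois.mem_bot_iff_fixed x).2 fun σ => h (σ.restrictScalars A)
  obtain ⟨y, rfl⟩ := IntermediateField.mem_bot.1 hb
  have hy : IsIntegral A y :=
    (isIntegral_algebraMap_iff (algebraMap (FractionRing A) L).injective).1 hx
  obtain ⟨z, rfl⟩ := IsIntegrallyClosed.isIntegral_iff.1 hy
  exact ⟨z, IsScalarTower.algebraMap_apply A (FractionRing A) L z⟩

theorem mem_range_algebraMap_of_isIntegral_of_mul_eq {A L : Type*} [CommRing A] [IsDomain A]
    [IsIntegrallyClosed A] [Field L] [Algebra A L] [FaithfulSMul A L]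
    {x : L} (hx : IsIntegral A x) {a b : A} (ha : a ≠ 0)
    (h : x * algebraMap A L a = algebraMap A L b) :
    x ∈ (algebraMap A L).range := by
  let := FractionRing.liftAlgebra A L
  have : IsScalarTower A (FractionRing A) L := FractionRing.isScalarTower_liftAlgebra A L
  have hy : x = algebraMap (FractionRing A) L
      (algebraMap A (FractionRing A) b / algebraMap A (FractionRing A) a) := by
    rw [map_div₀, ← IsScalarTower.algebraMap_apply, ← IsScalarTower.algebraMap_apply, eq_div_iff, h]
    exact (map_ne_zero_iff _ (FaithfulSMul.algebraMap_injective A L)).2 ha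
  subst hy
  obtain ⟨z, hz⟩ := IsIntegrallyClosed.isIntegral_iff.1
    ((isIntegral_algebraMap_iff (algebraMap (FractionRing A) L).injective).1 hx)
  exact ⟨z, by rw [← hz, ← IsScalarTower.algebraMap_apply A (FractionRing A) L z]⟩

theorem isIntegrallyClosed_adjoin_singleton {L : Type*} [Field L] {t : L}
    (ht : Transcendental ℤ t) : IsIntegrallyClosed (Algebra.adjoin ℤ {t}) := by
  have e : ℤ[X] ≃ₐ[ℤ] Algebra.adjoin ℤ {t} :=
    (AlgEquiv.ofInjective (aeval t) (transcendental_iff_injective.1 ht)).trans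
      (Subalgebra.equivOfEq _ _ (Algebra.adjoin_singleton_eq_range_aeval ℤ t).symm)
  exact IsIntegrallyClosed.of_equiv e.toRingEquiv

/-- The subring of elements of `L` that are integral over `ℤ[t]`. -/
noncomputable def integralOver {L : Type*} [Field L] (t : L) : Subring L :=
  (integralClosure (Algebra.adjoin ℤ {t}) L).toSubring

theorem mem_integralOver {L : Type*} [Field L] {t x : L} :
    x ∈ integralOver t ↔ IsIntegral (Algebra.adjoin ℤ {t}) x := Iff.rfl

theorem self_mem_integralOver {L : Type*} [Field L] (t : L) : t ∈ integralOver t :=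
  mem_integralOver.2 (isIntegral_algebraMap
    (x := (⟨t, Algebra.self_mem_adjoin_singleton ℤ t⟩ : Algebra.adjoin ℤ {t})))

theorem mem_integralOver_of_isIntegral {L : Type*} [Field L] {t x : L}
    (hx : IsIntegral (integralOver t) x) : x ∈ integralOver t := by
  change IsIntegral (integralClosure (Algebra.adjoin ℤ {t}) L) x at hx
  exact mem_integralOver.2 (isIntegral_trans x hx)

theorem mem_integralOver_of_pow_mem {L : Type*} [Field L] {t x : L} {n : ℕ} (hn : n ≠ 0)
    (hx : x ^ n ∈ integralOver t) : x ∈ integralOver t :=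
  mem_integralOver.2 (IsIntegral.of_pow (Nat.pos_of_ne_zero hn) (mem_integralOver.1 hx))

theorem mem_integralOver_of_pow_eq_mul_add {L : Type*} [Field L] {t : L} {d m : ℕ} (hd : 2 ≤ d)
    (hm : m ≠ 0) {a b : L} (ha : a ∈ integralOver t) (hb : b ∈ integralOver t) (u : ℕ → L)
    (hu : ∀ i, u i ^ d = a * u (i + 1) + b) (hum : u m = u 0) : u 0 ∈ integralOver t :=
  mem_integralOver_of_isIntegral
    (isIntegral_of_pow_eq_mul_add hd hm (⟨a, ha⟩ : integralOver t) ⟨b, hb⟩ u hu hum)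

theorem exists_aeval_eq_of_fixed {L : Type*} [Field L] [IsAlgClosed L] [CharZero L] {t : L}
    (ht : Transcendental ℤ t) (halg : Algebra.IsAlgebraic (Algebra.adjoin ℤ {t}) L) {x : L}
    (hx : x ∈ integralOver t) (h : ∀ σ : L ≃+* L, σ t = t → σ x = x) :
    ∃ p : ℤ[X], aeval t p = x := by
  have := isIntegrallyClosed_adjoin_singleton ht
  obtain ⟨y, hy⟩ := mem_range_algebraMap_of_isIntegral_of_fixed (mem_integralOver.1 hx) fun σ =>
    h σ.toRingEquiv
      (σ.commutes (⟨t, Algebra.self_mem_adjoin_singleton ℤ t⟩ : Algebra.adjoin ℤ {t}))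
  obtain ⟨p, hp⟩ := (Algebra.adjoin_singleton_eq_range_aeval ℤ t).le y.2
  exact ⟨p, hp.trans hy⟩

/-- Here `t = w^(-e)`, so `p(t) w^(e deg p)` is the reverse of `p` evaluated at `w^e`, whose
constant term is the leading coefficient of `p`. If a smaller power of `w` already made `p(t)`
integral, hence a polynomial in `w`, that constant term would vanish. -/
theorem mul_natDegree_le_of_mul_pow_mem_integralOver {L : Type*} [Field L] {t w : L}
    (hw : Transcendental ℤ w) {e k : ℕ} (he : e ≠ 0) (ht : t * w ^ e = 1) (p : ℤ[X])
    (h : aeval t p * w ^ k ∈ integralOver w) : e * p.natDegree ≤ k := by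
  have := isIntegrallyClosed_adjoin_singleton hw
  by_contra! hlt
  have hinj := transcendental_iff_injective.1 hw
  obtain ⟨r, hr⟩ := Nat.exists_eq_add_of_lt hlt
  have hrange : ∀ q : ℤ[X], aeval w q ∈ Algebra.adjoin ℤ {w} := fun q => by
    rw [Algebra.adjoin_singleton_eq_range_aeval]; exact ⟨q, rfl⟩
  have hrev : aeval t p * w ^ k * w ^ (r + 1) = aeval w (expand ℤ e p.reverse) := by
    have h0 : w ^ e ≠ 0 := right_ne_zero_of_mul_eq_one ht
    have htu : t ≠ 0 := left_ne_zero_of_mul_eq_one ht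
    let : Invertible t := invertibleOfNonzero htu
    have := eval₂_reverse_mul_pow (algebraMap ℤ L) t p
    rw [expand_aeval, aeval_def, aeval_def, ← this, mul_assoc, mul_assoc, ← pow_add,
      show k + (r + 1) = e * p.natDegree by omega, pow_mul, ← mul_pow, ht, one_pow, mul_one,
      invOf_eq_inv, eq_inv_of_mul_eq_one_right ht]
  have hX : (⟨aeval w ((X : ℤ[X]) ^ (r + 1)), hrange _⟩ : Algebra.adjoin ℤ {w}) ≠ 0 := by
    intro h0
    have := congrArg Subtype.val h0
    exact pow_ne_zero (r + 1) X_ne_zero (hinj (this.trans (map_zero _).symm))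
  obtain ⟨y, hy⟩ := mem_range_algebraMap_of_isIntegral_of_mul_eq (mem_integralOver.1 h) hX
    (b := ⟨aeval w (expand ℤ e p.reverse), hrange _⟩) (by
      change _ * aeval w ((X : ℤ[X]) ^ (r + 1)) = _
      simpa using hrev)
  obtain ⟨q, hq⟩ := (Algebra.adjoin_singleton_eq_range_aeval ℤ w).le y.2
  have hq' : aeval w q = aeval t p * w ^ k := hq.trans hy
  have hpoly : q * X ^ (r + 1) = expand ℤ e p.reverse := hinj (by
    rw [map_mul, hq', map_pow, aeval_X, hrev])
  have hz := congrArg (fun g : ℤ[X] => g.coeff 0) hpoly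
  simp only [pow_succ, ← mul_assoc, coeff_mul_X_zero] at hz
  rw [coeff_expand (Nat.pos_of_ne_zero he)] at hz
  simp only [dvd_zero, if_true, Nat.zero_div, coeff_zero_reverse] at hz
  have hp : p = 0 := leadingCoeff_eq_zero.1 hz.symm
  simp [hp] at hlt

/-! ### Iterates of the unicritical map -/

/-- The map `z ↦ z ^ d + c`. -/
def unicriticalMap {L : Type*} [CommRing L] (d : ℕ) (c z : L) : L := z ^ d + c

/-- The multiplier of `z ↦ z ^ d + c` along `m` steps of the orbit of `z`. -/
def orbitMultiplier {L : Type*} [CommRing L] (d : ℕ) (c : L) (m : ℕ) (z : L) : L :=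
  ∏ i ∈ Finset.range m, (d : L) * ((unicriticalMap d c)^[i] z) ^ (d - 1)

theorem iter_unicritical_succ (d k : ℕ) :
    iter (unicritical d) (k + 1) = iter (unicritical d) k ^ d + C X := by
  rw [iter, Function.iterate_succ_apply', ← iter]
  simp [unicritical]

theorem iter_zero {O : Type*} [CommRing O] (f : O[X]) : iter f 0 = X := rfl

theorem monic_natDegree_iter {d : ℕ} (hd : 2 ≤ d) (k : ℕ) :
    (iter (unicritical d) k).Monic ∧ (iter (unicritical d) k).natDegree = d ^ k := by
  induction k with
  | zero => simp [iter_zero, monic_X]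
  | succ k ih =>
    have hdeg : (iter (unicritical d) k ^ d).natDegree = d ^ (k + 1) := by
      rw [ih.1.natDegree_pow, ih.2, pow_succ']
    rw [iter_unicritical_succ]
    refine ⟨(ih.1.pow d).add_of_left (degree_C_le.trans_lt (natDegree_pos_iff_degree_pos.1 ?_)), ?_⟩
    · rw [hdeg]; positivity
    · rw [natDegree_add_C, hdeg]

theorem monic_natDegree_iter_sub_X {d : ℕ} (hd : 2 ≤ d) {k : ℕ} (hk : k ≠ 0) :
    (iter (unicritical d) k - X).Monic ∧ (iter (unicritical d) k - X).natDegree = d ^ k := by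
  obtain ⟨h1, h2⟩ := monic_natDegree_iter hd k
  have hlt : 1 < d ^ k := Nat.one_lt_pow hk (by omega)
  refine ⟨h1.sub_of_left ?_, ?_⟩
  · rw [degree_X, degree_eq_natDegree h1.ne_zero, h2]
    exact_mod_cast hlt
  · rw [natDegree_sub_eq_left_of_natDegree_lt (by rw [h2, natDegree_X]; exact hlt), h2]

/-! ### Simplicity of periodic points and the dynatomic factorisation -/

section Points

variable {L : Type*} [Field L] [Algebra ℤ[X] L]

theorem aeval_iter_unicritical (d k : ℕ) (z : L) :
    aeval z (iter (unicritical d) k) = (unicriticalMap d (algebraMap ℤ[X] L X))^[k] z := by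
  induction k with
  | zero => simp [iter_zero]
  | succ k ih =>
    rw [iter_unicritical_succ, Function.iterate_succ_apply', ← ih]
    simp [unicriticalMap]

theorem multiplier_unicritical (d m : ℕ) (z : L) :
    multiplier (unicritical d) m z = orbitMultiplier d (algebraMap ℤ[X] L X) m z := by
  rw [multiplier, orbitMultiplier]
  induction m with
  | zero => simp [iter_zero]
  | succ m ih =>
    rw [iter_unicritical_succ, Finset.prod_range_succ, ← ih, derivative_add, derivative_C,
      derivative_pow, add_zero, map_mul, map_mul, map_pow, aeval_iter_unicritical]
    simp
    ring

variable (L) in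
open Classical in
/-- The points of exact period `k` of `z ↦ z ^ d + c`. -/
noncomputable def exactPeriodPoints (d k : ℕ) : Finset L :=
  ((iter (unicritical d) k - X).aroots L).toFinset.filter fun z =>
    Function.minimalPeriod (unicriticalMap d (algebraMap ℤ[X] L X)) z = k

variable (L) in
/-- The monic polynomial whose simple roots are the points of exact period `k`. -/
noncomputable def exactPeriodPoly (d k : ℕ) : L[X] :=
  ∏ z ∈ exactPeriodPoints L d k, (X - C z)

theorem monic_exactPeriodPoly (d k : ℕ) : (exactPeriodPoly L d k).Monic :=
  monic_prod_of_monic _ _ fun z _ => monic_X_sub_C z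

variable [FaithfulSMul ℤ[X] L]

/-- The multiplier is `d` times an element integral over `ℤ[c]`. Were it `1`, then `1/d` would be
integral over the integrally closed ring `ℤ[c]`, making `d` a unit. -/
theorem orbitMultiplier_ne_one {d : ℕ} (hd : 2 ≤ d) {k : ℕ} (hk : k ≠ 0) {z : L}
    (hz : aeval z (iter (unicritical d) k - X) = 0) :
    orbitMultiplier d (algebraMap ℤ[X] L X) k z ≠ 1 := by
  intro h
  have hint : ∀ i, IsIntegral ℤ[X] ((unicriticalMap d (algebraMap ℤ[X] L X))^[i] z) := by
    intro i
    induction i with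
    | zero => exact ⟨_, (monic_natDegree_iter_sub_X hd hk).1, hz⟩
    | succ i ih =>
      rw [Function.iterate_succ_apply']
      exact (ih.pow d).add isIntegral_algebraMap
  obtain ⟨k, rfl⟩ := Nat.exists_eq_succ_of_ne_zero hk
  rw [orbitMultiplier, Finset.prod_range_succ, ← mul_assoc, mul_comm _ (d : L), mul_assoc] at h
  have hx := (IsIntegral.prod (R := ℤ[X])
    (fun i => (d : L) * ((unicriticalMap d (algebraMap ℤ[X] L X))^[i] z) ^ (d - 1))
    (s := Finset.range k) (fun i _ => (isIntegral_natCast (a := d)).mul ((hint i).pow _))).mul ((hint k).pow (d - 1))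
  obtain ⟨q, hq⟩ := mem_range_algebraMap_of_isIntegral_of_mul_eq hx (a := (d : ℤ[X])) (b := 1)
    (by exact_mod_cast (by omega : d ≠ 0)) (by rw [map_natCast, map_one, mul_comm, h])
  rw [← hq, ← map_natCast (algebraMap ℤ[X] L), ← map_mul, ← map_one (algebraMap ℤ[X] L)] at h
  -- Specialising `c = 0` turns `d * q = 1` in `ℤ[c]` into an identity of integers.
  have h1 := congrArg (eval 0) (FaithfulSMul.algebraMap_injective ℤ[X] L h)
  simp only [eval_mul, eval_natCast, eval_one] at h1
  have h2 : IsUnit (d : ℤ) := IsUnit.of_mul_eq_one _ h1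
  rw [Int.isUnit_iff] at h2
  omega

/-- At a multiple root the derivative `(f^k)' - 1` vanishes, so the multiplier would be `1`. -/
theorem nodup_aroots_iter_sub_X {d : ℕ} (hd : 2 ≤ d) {k : ℕ} (hk : k ≠ 0) :
    ((iter (unicritical d) k - X).aroots L).Nodup := by
  classical
  have hm := (monic_natDegree_iter_sub_X hd hk).1.map (algebraMap ℤ[X] L)
  rw [Multiset.nodup_iff_count_le_one]
  intro z
  by_contra! h
  rw [aroots, count_roots, one_lt_rootMultiplicity_iff_isRoot hm.ne_zero] at h
  obtain ⟨h1, h2⟩ := h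
  rw [IsRoot, eval_map_algebraMap] at h1
  rw [derivative_map, IsRoot, eval_map_algebraMap, derivative_sub, derivative_X, map_sub, map_one,
    sub_eq_zero] at h2
  refine orbitMultiplier_ne_one hd hk h1 ?_
  rw [← multiplier_unicritical, multiplier, h2]

theorem mem_aroots_iter_sub_X {d : ℕ} (hd : 2 ≤ d) {k : ℕ} (hk : k ≠ 0) {z : L} :
    z ∈ (iter (unicritical d) k - X).aroots L ↔
      Function.IsPeriodicPt (unicriticalMap d (algebraMap ℤ[X] L X)) k z := by
  rw [mem_aroots, map_sub, aeval_iter_unicritical, aeval_X, sub_eq_zero]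
  exact and_iff_right (monic_natDegree_iter_sub_X hd hk).1.ne_zero

theorem mem_exactPeriodPoints {d : ℕ} (hd : 2 ≤ d) {k : ℕ} (hk : k ≠ 0) {z : L} :
    z ∈ exactPeriodPoints L d k ↔
      Function.minimalPeriod (unicriticalMap d (algebraMap ℤ[X] L X)) z = k := by
  classical
  rw [exactPeriodPoints, Finset.mem_filter, Multiset.mem_toFinset, mem_aroots_iter_sub_X hd hk]
  refine and_iff_right_of_imp fun h => ?_
  have := Function.isPeriodicPt_minimalPeriod (unicriticalMap d (algebraMap ℤ[X] L X)) z
  rwa [h] at this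

theorem prod_exactPeriodPoly [IsAlgClosed L] {d : ℕ} (hd : 2 ≤ d) {k : ℕ} (hk : k ≠ 0) :
    ∏ j ∈ k.divisors, exactPeriodPoly L d j =
      (iter (unicritical d) k - X).map (algebraMap ℤ[X] L) := by
  classical
  have hm := (monic_natDegree_iter_sub_X hd hk).1.map (algebraMap ℤ[X] L)
  have hprod : ((iter (unicritical d) k - X).aroots L |>.map fun z => X - C z).prod =
      ∏ z ∈ ((iter (unicritical d) k - X).aroots L).toFinset, (X - C z) := by
    rw [Finset.prod, Multiset.toFinset_val, (nodup_aroots_iter_sub_X hd hk).dedup]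
  rw [(IsAlgClosed.splits _).eq_prod_roots_of_monic hm, ← aroots, hprod,
    ← Finset.prod_fiberwise_of_maps_to
      (g := Function.minimalPeriod (unicriticalMap d (algebraMap ℤ[X] L X))) (t := k.divisors)
      fun z hz => by
        rw [Multiset.mem_toFinset, mem_aroots_iter_sub_X hd hk] at hz
        exact Nat.mem_divisors.2 ⟨hz.minimalPeriod_dvd, hk⟩]
  refine Finset.prod_congr rfl fun j hj => ?_
  rw [Nat.mem_divisors] at hj
  have hj0 : j ≠ 0 := fun h => hk (by simpa [h] using hj.1)
  rw [exactPeriodPoly]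
  congr 1
  ext z
  rw [mem_exactPeriodPoints hd hj0, Finset.mem_filter, Multiset.mem_toFinset,
    mem_aroots_iter_sub_X hd hk, iff_and_self]
  rintro rfl
  exact (Function.isPeriodicPt_minimalPeriod _ z).trans_dvd hj.1

/-- Strong induction: divide `f^k(z) - z` over `ℤ[c]` by the monic product for the proper divisors.
Division by a monic polynomial commutes with base change, and over `L` it is exact. -/
theorem exists_map_eq_exactPeriodPoly [IsAlgClosed L] {d : ℕ} (hd : 2 ≤ d) (k : ℕ) (hk : k ≠ 0) :
    ∃ Φ : ℤ[X][X], Φ.Monic ∧ Φ.map (algebraMap ℤ[X] L) = exactPeriodPoly L d k := by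
  induction k using Nat.strong_induction_on with
  | _ k ih =>
    have ih' : ∀ j ∈ k.properDivisors, ∃ Φ : ℤ[X][X], Φ.Monic ∧
        Φ.map (algebraMap ℤ[X] L) = exactPeriodPoly L d j := fun j hj =>
      ih j (Nat.mem_properDivisors.1 hj).2
        fun h => hk (by simpa [h] using (Nat.mem_properDivisors.1 hj).1)
    choose! Φ hΦ hmap using ih'
    have hQ : (∏ j ∈ k.properDivisors, Φ j).Monic := monic_prod_of_monic _ _ hΦ
    have hQm : (∏ j ∈ k.properDivisors, Φ j).map (algebraMap ℤ[X] L) =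
        ∏ j ∈ k.properDivisors, exactPeriodPoly L d j := by
      rw [Polynomial.map_prod]
      exact Finset.prod_congr rfl hmap
    have hmap' : ((iter (unicritical d) k - X) /ₘ ∏ j ∈ k.properDivisors, Φ j).map
        (algebraMap ℤ[X] L) = exactPeriodPoly L d k := by
      rw [map_divByMonic _ hQ, ← prod_exactPeriodPoly hd hk, hQm,
        ← Nat.cons_self_properDivisors hk, Finset.prod_cons, mul_comm]
      exact mul_divByMonic_cancel_left _ (monic_prod_of_monic _ _ fun j _ =>
        monic_exactPeriodPoly d j)
    exact ⟨_, monic_of_injective (FaithfulSMul.algebraMap_injective ℤ[X] L)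
      (hmap' ▸ monic_exactPeriodPoly d k), hmap'⟩

end Points

/-! ### Möbius inversion, degrees and constant terms -/

theorem monic_natDegree_coeff_zero_iter {d : ℕ} (hd : 2 ≤ d) (k : ℕ) :
    ((iter (unicritical d) (k + 1)).coeff 0).Monic ∧
      ((iter (unicritical d) (k + 1)).coeff 0).natDegree = d ^ k := by
  induction k with
  | zero =>
    have : (iter (unicritical d) 1).coeff 0 = X := by
      rw [iter_unicritical_succ, iter_zero]
      simp [coeff_X_pow, show 0 ≠ d by omega]
    simp [this, monic_X]
  | succ k ih =>
    have hstep : (iter (unicritical d) (k + 1 + 1)).coeff 0 =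
        (iter (unicritical d) (k + 1)).coeff 0 ^ d + X := by
      rw [iter_unicritical_succ, coeff_add, coeff_C_zero]
      simp [coeff_zero_eq_eval_zero]
    have hdeg : ((iter (unicritical d) (k + 1)).coeff 0 ^ d).natDegree = d ^ (k + 1) := by
      rw [ih.1.natDegree_pow, ih.2, pow_succ']
    have hlt : 1 < d ^ (k + 1) := Nat.one_lt_pow (by omega) (by omega)
    rw [hstep]
    refine ⟨(ih.1.pow d).add_of_left ?_, ?_⟩
    · rw [degree_X, degree_eq_natDegree (ih.1.pow d).ne_zero, hdeg]
      exact_mod_cast hlt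
    · rw [natDegree_add_eq_left_of_natDegree_lt (by rw [hdeg, natDegree_X]; exact hlt), hdeg]

section Family

variable {d : ℕ} {Φ : ℕ → ℤ[X][X]}

theorem isDynatomicPolynomial_of_prod_eq (hd : 2 ≤ d) (hΦ : ∀ k, k ≠ 0 → (Φ k).Monic)
    (hprod : ∀ k, k ≠ 0 → ∏ j ∈ k.divisors, Φ j = iter (unicritical d) k - X)
    {m : ℕ} (hm : m ≠ 0) : IsDynatomicPolynomial (unicritical d) m (Φ m) := by
  have hinj := IsFractionRing.injective ℤ[X][X] (FractionRing ℤ[X][X])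
  have := (ArithmeticFunction.prod_eq_iff_prod_pow_moebius_eq_of_nonzero
    (f := fun k => algebraMap ℤ[X][X] (FractionRing ℤ[X][X]) (Φ k))
    (g := fun k => algebraMap ℤ[X][X] (FractionRing ℤ[X][X]) (iter (unicritical d) k - X))
    (fun k hk => (map_ne_zero_iff _ hinj).2 (hΦ k hk.ne').ne_zero)
    (fun k hk => (map_ne_zero_iff _ hinj).2
      (monic_natDegree_iter_sub_X hd hk.ne').1.ne_zero)).1
    (fun k hk => by rw [← hprod k hk.ne', map_prod]) m (Nat.pos_of_ne_zero hm)
  rw [IsDynatomicPolynomial, ← this, Nat.prod_divisorsAntidiagonal' fun i j =>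
    algebraMap ℤ[X][X] (FractionRing ℤ[X][X]) (iter (unicritical d) j - X) ^
      ArithmeticFunction.moebius i]

theorem natDegree_eq_formalDegree (hd : 2 ≤ d) (hΦ : ∀ k, k ≠ 0 → (Φ k).Monic)
    (hprod : ∀ k, k ≠ 0 → ∏ j ∈ k.divisors, Φ j = iter (unicritical d) k - X)
    {m : ℕ} (hm : m ≠ 0) : ((Φ m).natDegree : ℤ) = formalDegree d m := by
  have := (ArithmeticFunction.sum_eq_iff_sum_mul_moebius_eq
    (f := fun k => ((Φ k).natDegree : ℤ)) (g := fun k => (d : ℤ) ^ k)).1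
    (fun k hk => by
      have h := congrArg natDegree (hprod k hk.ne')
      rw [natDegree_prod_of_monic _ _ fun j hj => hΦ j (Nat.pos_of_mem_divisors hj).ne',
        (monic_natDegree_iter_sub_X hd hk.ne').2] at h
      exact_mod_cast h) m (Nat.pos_of_ne_zero hm)
  simp only [Int.cast_id] at this
  rw [formalDegree, ← this, Nat.sum_divisorsAntidiagonal' fun i j =>
    ArithmeticFunction.moebius i * (d : ℤ) ^ j]
  exact Finset.sum_congr rfl fun k _ => mul_comm _ _

/-- For the whole product the constant term `f^m(0)` is monic in `c` of degree `d^(m-1)`, against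
degree `d^m` in `z`. Both properties pass to the new factor by cancelling the proper divisors. -/
theorem monic_natDegree_coeff_zero (hd : 2 ≤ d) (hΦ : ∀ k, k ≠ 0 → (Φ k).Monic)
    (hprod : ∀ k, k ≠ 0 → ∏ j ∈ k.divisors, Φ j = iter (unicritical d) k - X)
    {m : ℕ} (hm : m ≠ 0) :
    ((Φ m).coeff 0).Monic ∧ d * ((Φ m).coeff 0).natDegree = (Φ m).natDegree := by
  induction m using Nat.strong_induction_on with
  | _ m ih =>
    have ih' : ∀ j ∈ m.properDivisors, ((Φ j).coeff 0).Monic ∧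
        d * ((Φ j).coeff 0).natDegree = (Φ j).natDegree := fun j hj =>
      ih j (Nat.mem_properDivisors.1 hj).2
        fun h => hm (by simpa [h] using (Nat.mem_properDivisors.1 hj).1)
    have hne : ∀ j ∈ m.properDivisors, j ≠ 0 := fun j hj h =>
      hm (by simpa [h] using (Nat.mem_properDivisors.1 hj).1)
    have hP := hprod m hm
    rw [← Nat.cons_self_properDivisors hm, Finset.prod_cons] at hP
    have h0 : (Φ m).coeff 0 * ∏ j ∈ m.properDivisors, (Φ j).coeff 0 =
        (iter (unicritical d) m).coeff 0 := by
      have := congrArg (eval 0) hP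
      simpa [eval_prod, coeff_zero_eq_eval_zero] using this
    have hQ : (∏ j ∈ m.properDivisors, (Φ j).coeff 0).Monic :=
      monic_prod_of_monic _ _ fun j hj => (ih' j hj).1
    obtain ⟨l, rfl⟩ := Nat.exists_eq_succ_of_ne_zero hm
    obtain ⟨hmon, hdeg⟩ := monic_natDegree_coeff_zero_iter hd l
    rw [← h0] at hmon hdeg
    have hmonic : ((Φ (l + 1)).coeff 0).Monic := hQ.of_mul_monic_right hmon
    refine ⟨hmonic, ?_⟩
    rw [hmonic.natDegree_mul hQ, natDegree_prod_of_monic _ _ fun j hj => (ih' j hj).1] at hdeg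
    have hdeg2 := congrArg natDegree hP
    rw [(hΦ _ hm).natDegree_mul (monic_prod_of_monic _ _ fun j hj => hΦ j (hne j hj)),
      natDegree_prod_of_monic _ _ fun j hj => hΦ j (hne j hj),
      (monic_natDegree_iter_sub_X hd hm).2, ← Finset.sum_congr rfl fun j hj => (ih' j hj).2,
      ← Finset.mul_sum, pow_succ', ← hdeg, mul_add] at hdeg2
    exact (Nat.add_right_cancel hdeg2).symm

end Family

theorem IsDynatomicPolynomial.unique {O : Type*} [CommRing O] [IsDomain O] {f : O[X]} {m : ℕ}
    {Φ Φ' : O[X]} (h : IsDynatomicPolynomial f m Φ) (h' : IsDynatomicPolynomial f m Φ') :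
    Φ = Φ' :=
  IsFractionRing.injective O[X] (FractionRing O[X]) (h.trans h'.symm)

theorem exists_dynatomicPolynomial (L : Type*) [Field L] [IsAlgClosed L] [Algebra ℤ[X] L]
    [FaithfulSMul ℤ[X] L] {d : ℕ} (hd : 2 ≤ d) {m : ℕ} (hm : m ≠ 0) :
    ∃ Φ : ℤ[X][X], IsDynatomicPolynomial (unicritical d) m Φ ∧
      Φ.map (algebraMap ℤ[X] L) = exactPeriodPoly L d m ∧
      (Φ.natDegree : ℤ) = formalDegree d m ∧
      (Φ.coeff 0).Monic ∧ d * (Φ.coeff 0).natDegree = Φ.natDegree := by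
  choose! Φ hΦ hmap using exists_map_eq_exactPeriodPoly (L := L) hd
  have hprod : ∀ k, k ≠ 0 → ∏ j ∈ k.divisors, Φ j = iter (unicritical d) k - X := by
    intro k hk
    apply map_injective _ (FaithfulSMul.algebraMap_injective ℤ[X] L)
    rw [Polynomial.map_prod, ← prod_exactPeriodPoly hd hk]
    exact Finset.prod_congr rfl fun j hj => hmap j (Nat.pos_of_mem_divisors hj).ne'
  exact ⟨Φ m, isDynatomicPolynomial_of_prod_eq hd hΦ hprod hm, hmap m hm,
    natDegree_eq_formalDegree hd hΦ hprod hm, monic_natDegree_coeff_zero hd hΦ hprod hm⟩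

/-! ### Multipliers along rescaled orbits -/

section Multipliers

variable {L : Type*} [Field L]

theorem orbitMultiplier_unicriticalMap (d : ℕ) (c : L) {m : ℕ} {z : L}
    (hz : Function.IsPeriodicPt (unicriticalMap d c) m z) :
    orbitMultiplier d c m (unicriticalMap d c z) = orbitMultiplier d c m z := by
  rcases m with _ | l
  · simp [orbitMultiplier]
  rw [orbitMultiplier, orbitMultiplier, Finset.prod_range_succ, Finset.prod_range_succ']
  simp only [← Function.iterate_succ_apply, Function.iterate_zero, id_eq]
  rw [hz.eq]

/-- The orbit `u_i = μ z_i` satisfies `u_i^d = μ^(d-1) u_(i+1) - μ^d c`, so it is integral, and each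
factor `d z_i^(d-1) ρ` equals `u_i^(d-1)`. The choice `ρ = 1` gives integrality over `ℤ[t]`; a
negative power of `y` gives the degree bound. -/
theorem orbitMultiplier_mul_pow_mem_integralOver {d m : ℕ} (hd : 2 ≤ d) (hm : m ≠ 0)
    {b c μ ρ : L} (hμ : μ ^ (d - 1) = d * ρ) (h1 : μ ^ (d - 1) ∈ integralOver b)
    (h2 : μ ^ d * c ∈ integralOver b) {z : L}
    (hz : Function.IsPeriodicPt (unicriticalMap d c) m z) :
    orbitMultiplier d c m z * ρ ^ m ∈ integralOver b := by
  have hmem : ∀ i, μ * (unicriticalMap d c)^[i] z ∈ integralOver b := by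
    intro i
    refine mem_integralOver_of_pow_eq_mul_add (u := fun j => μ * (unicriticalMap d c)^[j + i] z)
      hd hm h1 ((integralOver b).neg_mem h2) (fun j => ?_) ?_ |> fun h => by simpa using h
    · rw [show j + 1 + i = (j + i) + 1 by omega, Function.iterate_succ_apply', unicriticalMap,
        mul_pow, ← mul_assoc, ← pow_succ, Nat.sub_add_cancel (by omega : 1 ≤ d)]
      ring
    · rw [zero_add, add_comm, Function.iterate_add_apply, hz.eq]
  have : orbitMultiplier d c m z * ρ ^ m =
      ∏ i ∈ Finset.range m, (μ * (unicriticalMap d c)^[i] z) ^ (d - 1) := by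
    rw [orbitMultiplier, ← Finset.card_range m, ← Finset.prod_const, Finset.card_range,
      ← Finset.prod_mul_distrib]
    refine Finset.prod_congr rfl fun i _ => ?_
    rw [mul_pow, hμ]
    ring
  rw [this]
  exact (integralOver b).prod_mem fun i _ => (integralOver b).pow_mem (hmem i) _

end Multipliers

/-! ### The multiplier polynomial and its symmetry -/

section MultiplierPolynomial

variable {L : Type*} [Field L] [Algebra ℤ[X] L]

variable (L) in
open Classical in
/-- The multiplier polynomial: each multiplier `w` of a point of exact period `m` is a root with
multiplicity the number of `m`-cycles of multiplier `w`. -/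
noncomputable def multiplierPoly (d m : ℕ) : L[X] :=
  ∏ w ∈ (exactPeriodPoints L d m).image (orbitMultiplier d (algebraMap ℤ[X] L X) m),
    (X - C w) ^ (((exactPeriodPoints L d m).filter fun z =>
      orbitMultiplier d (algebraMap ℤ[X] L X) m z = w).card / m)

theorem monic_multiplierPoly (d m : ℕ) : (multiplierPoly L d m).Monic :=
  monic_prod_of_monic _ _ fun w _ => (monic_X_sub_C w).pow _

variable [FaithfulSMul ℤ[X] L] {d m : ℕ}

theorem isPeriodicPt_of_mem_exactPeriodPoints (hd : 2 ≤ d) (hm : m ≠ 0) {z : L}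
    (hz : z ∈ exactPeriodPoints L d m) :
    Function.IsPeriodicPt (unicriticalMap d (algebraMap ℤ[X] L X)) m z := by
  have := Function.isPeriodicPt_minimalPeriod (unicriticalMap d (algebraMap ℤ[X] L X)) z
  rwa [(mem_exactPeriodPoints hd hm).1 hz] at this

open Classical in
theorem exists_card_fiber_eq_mul (hd : 2 ≤ d) (hm : m ≠ 0) (w : L) :
    ∃ n, ((exactPeriodPoints L d m).filter fun z =>
        orbitMultiplier d (algebraMap ℤ[X] L X) m z = w).card = m * n ∧
      ∏ z ∈ (exactPeriodPoints L d m).filter fun z =>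
        orbitMultiplier d (algebraMap ℤ[X] L X) m z = w, (d : L) * z ^ (d - 1) = w ^ n := by
  refine exists_card_eq_mul_and_prod_eq_pow (unicriticalMap d (algebraMap ℤ[X] L X))
    (fun z => (d : L) * z ^ (d - 1)) w (Nat.pos_of_ne_zero hm) _ ?_ ?_ ?_
  · intro z hz
    rw [Finset.mem_filter] at hz ⊢
    have hper := isPeriodicPt_of_mem_exactPeriodPoints hd hm hz.1
    refine ⟨?_, by rw [orbitMultiplier_unicriticalMap _ _ hper, hz.2]⟩
    rw [mem_exactPeriodPoints hd hm, Function.minimalPeriod_apply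
      (Function.mk_mem_periodicPts (Nat.pos_of_ne_zero hm) hper)]
    exact (mem_exactPeriodPoints hd hm).1 hz.1
  · exact fun z hz => (mem_exactPeriodPoints hd hm).1 (Finset.mem_filter.1 hz).1
  · exact fun z hz => (Finset.mem_filter.1 hz).2

theorem multiplierPoly_pow (hd : 2 ≤ d) (hm : m ≠ 0) :
    multiplierPoly L d m ^ m = ∏ z ∈ exactPeriodPoints L d m,
      (X - C (orbitMultiplier d (algebraMap ℤ[X] L X) m z)) := by
  classical
  rw [multiplierPoly, ← Finset.prod_pow]
  refine Eq.trans ?_ (Finset.prod_fiberwise_of_maps_to (fun z hz => Finset.mem_image_of_mem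
    (orbitMultiplier d (algebraMap ℤ[X] L X) m) hz) _)
  refine Finset.prod_congr rfl fun w _ => ?_
  rw [Finset.prod_congr rfl (g := fun _ => X - C w) fun z hz => by rw [(Finset.mem_filter.1 hz).2],
    Finset.prod_const, ← pow_mul]
  obtain ⟨n, hn, -⟩ := exists_card_fiber_eq_mul (L := L) hd hm w
  rw [Nat.div_mul_cancel ⟨n, hn⟩]

theorem mul_natDegree_multiplierPoly (hd : 2 ≤ d) (hm : m ≠ 0) :
    m * (multiplierPoly L d m).natDegree = (exactPeriodPoints L d m).card := by
  have h := congrArg natDegree (multiplierPoly_pow (L := L) hd hm)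
  rwa [(monic_multiplierPoly d m).natDegree_pow, natDegree_prod_of_monic _ _
    fun z _ => monic_X_sub_C _, Finset.sum_congr rfl fun z _ => natDegree_X_sub_C _,
    Finset.sum_const, smul_eq_mul, mul_one] at h

/-- Each cycle contributes its multiplier once, and that multiplier is the product of `f'` over the
points of the cycle; altogether every point occurs once. -/
theorem coeff_zero_multiplierPoly (hd : 2 ≤ d) (hm : m ≠ 0) :
    (multiplierPoly L d m).coeff 0 = (-1) ^ (multiplierPoly L d m).natDegree *
      ∏ z ∈ exactPeriodPoints L d m, ((d : L) * z ^ (d - 1)) := by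
  classical
  have hdeg : (multiplierPoly L d m).natDegree = _ :=
    natDegree_prod_of_monic _ _ fun w _ => (monic_X_sub_C w).pow _
  simp only [natDegree_pow, natDegree_X_sub_C, mul_one] at hdeg
  rw [hdeg, ← Finset.prod_fiberwise_of_maps_to fun z hz => Finset.mem_image_of_mem
      (orbitMultiplier d (algebraMap ℤ[X] L X) m) hz, ← Finset.prod_pow_eq_pow_sum,
    ← Finset.prod_mul_distrib, coeff_zero_eq_eval_zero, multiplierPoly, eval_prod]
  refine Finset.prod_congr rfl fun w _ => ?_
  obtain ⟨n, hn, hprod⟩ := exists_card_fiber_eq_mul (L := L) hd hm w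
  rw [hprod, hn, Nat.mul_div_cancel_left _ (Nat.pos_of_ne_zero hm), ← mul_pow]
  simp

theorem exists_eq_orbitMultiplier_of_mem_roots (hd : 2 ≤ d) (hm : m ≠ 0) {a : L}
    (ha : a ∈ (multiplierPoly L d m).roots) :
    ∃ z ∈ exactPeriodPoints L d m, orbitMultiplier d (algebraMap ℤ[X] L X) m z = a := by
  have h := congrArg (eval a) (multiplierPoly_pow (L := L) hd hm)
  rw [eval_pow, (mem_roots'.1 ha).2.eq_zero, zero_pow hm, eval_prod, eq_comm,
    Finset.prod_eq_zero_iff] at h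
  obtain ⟨z, hz, h⟩ := h
  rw [eval_sub, eval_X, eval_C, sub_eq_zero] at h
  exact ⟨z, hz, h.symm⟩

theorem coeff_multiplierPoly_mul_pow_mem [IsAlgClosed L] (hd : 2 ≤ d) (hm : m ≠ 0)
    {b μ ρ : L} (hμ : μ ^ (d - 1) = d * ρ) (h1 : μ ^ (d - 1) ∈ integralOver b)
    (h2 : μ ^ d * algebraMap ℤ[X] L X ∈ integralOver b) (j : ℕ) :
    (multiplierPoly L d m).coeff j * (ρ ^ m) ^ ((multiplierPoly L d m).natDegree - j) ∈
      integralOver b := by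
  have hs := IsAlgClosed.splits (multiplierPoly L d m)
  have := coeff_prod_X_sub_C_mul_pow_mem (integralOver b) (ρ ^ m) (multiplierPoly L d m).roots
    (fun a ha => by
      obtain ⟨z, hz, rfl⟩ := exists_eq_orbitMultiplier_of_mem_roots hd hm ha
      exact orbitMultiplier_mul_pow_mem_integralOver hd hm hμ h1 h2
        (isPeriodicPt_of_mem_exactPeriodPoints hd hm hz)) j
  rwa [← hs.eq_prod_roots_of_monic (monic_multiplierPoly d m), ← hs.natDegree_eq_card_roots] at this

/-- With `η = c / σ c`, a `(d-1)`-th root of unity, `τ z = η σ(z)` commutes with `z ↦ z^d + c`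
because `η^d = η`. It permutes the points of exact period `m` and carries multipliers to their
images under `σ`, the factors `η^(d-1)` being `1`. -/
theorem map_multiplierPoly (hd : 2 ≤ d) (hm : m ≠ 0) (σ : L ≃+* L)
    (hσ : σ (algebraMap ℤ[X] L X) ^ (d - 1) = algebraMap ℤ[X] L X ^ (d - 1)) :
    (multiplierPoly L d m).map (σ : L →+* L) = multiplierPoly L d m := by
  set c := algebraMap ℤ[X] L X with hc
  have hc0 : c ≠ 0 := (map_ne_zero_iff _ (FaithfulSMul.algebraMap_injective ℤ[X] L)).2 X_ne_zero
  have hσc0 : σ c ≠ 0 := (map_ne_zero_iff _ σ.injective).2 hc0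
  let η := c / σ c
  have hη0 : η ≠ 0 := div_ne_zero hc0 hσc0
  have hη : η ^ (d - 1) = 1 := by rw [div_pow, hσ, div_self (pow_ne_zero _ hc0)]
  have hηd : η ^ d = η := by
    rw [← Nat.sub_add_cancel (by omega : 1 ≤ d), pow_succ, hη, one_mul]
  let τ : L → L := fun z => η * σ z
  have hτinj : Function.Injective τ := fun x y h => σ.injective (mul_left_cancel₀ hη0 h)
  have hsemi : Function.Semiconj τ (unicriticalMap d c) (unicriticalMap d c) := fun z => by
    change η * σ (z ^ d + c) = (η * σ z) ^ d + c
    rw [map_add, map_pow, mul_add, mul_pow, hηd, div_mul_cancel₀ _ hσc0]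
  have hiter : ∀ k z, (unicriticalMap d c)^[k] (τ z) = τ ((unicriticalMap d c)^[k] z) :=
    fun k z => (hsemi.iterate_right k z).symm
  have hmaps : ∀ z ∈ exactPeriodPoints L d m, τ z ∈ exactPeriodPoints L d m := fun z hz => by
    rw [mem_exactPeriodPoints hd hm] at hz ⊢
    rw [← hz, Function.minimalPeriod_eq_minimalPeriod_iff]
    intro n
    rw [Function.IsPeriodicPt, Function.IsFixedPt, ← hc, hiter, hτinj.eq_iff]
    rfl
  have hmult : ∀ z, orbitMultiplier d c m (τ z) = σ (orbitMultiplier d c m z) := fun z => by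
    rw [orbitMultiplier, orbitMultiplier, map_prod]
    refine Finset.prod_congr rfl fun i _ => ?_
    rw [hiter, map_mul, map_pow, map_natCast, mul_pow, hη, one_mul]
  refine monic_eq_of_pow_eq ((monic_multiplierPoly d m).map _) (monic_multiplierPoly d m) hm ?_
  rw [← Polynomial.map_pow, multiplierPoly_pow hd hm, Polynomial.map_prod]
  refine Finset.prod_nbij τ hmaps hτinj.injOn
    (Finset.surjOn_of_injOn_of_card_le _ hmaps hτinj.injOn le_rfl) fun z _ => ?_
  rw [Polynomial.map_sub, map_X, map_C, ← hc, hmult]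
  rfl

theorem isMultiplierPolynomial_iff {O : Type*} [CommRing O] [IsDomain O] {f : O[X]}
    {n : ℕ} {Φ : O[X]} (h : IsDynatomicPolynomial f n Φ) {δ : (GeomField O)[X]} :
    IsMultiplierPolynomial f n δ ↔ δ.Monic ∧
      δ ^ n = ((Φ.aroots (GeomField O)).map fun α => X - C (multiplier f n α)).prod := by
  constructor
  · rintro ⟨Φ', hΦ', hδ⟩
    rwa [hΦ'.unique h] at hδ
  · exact fun hδ => ⟨Φ, h, hδ⟩

theorem prod_aroots_eq_multiplierPoly_pow (hd : 2 ≤ d) (hm : m ≠ 0) {Φ : ℤ[X][X]}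
    (hΦ : Φ.map (algebraMap ℤ[X] L) = exactPeriodPoly L d m) :
    ((Φ.aroots L).map fun α => X - C (multiplier (unicritical d) m α)).prod =
      multiplierPoly L d m ^ m := by
  rw [multiplierPoly_pow hd hm, aroots, hΦ, exactPeriodPoly, roots_prod_X_sub_C]
  simp only [multiplier_unicritical]
  rfl

end MultiplierPolynomial

/-! ### Coefficients as polynomials in `t` and their degrees -/

section Parameter

variable {L : Type*} [Field L] [Algebra ℤ[X] L] [FaithfulSMul ℤ[X] L]

theorem charZero_of_algebra_polynomial_int (L : Type*) [Field L] [Algebra ℤ[X] L]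
    [FaithfulSMul ℤ[X] L] : CharZero L :=
  charZero_of_injective_algebraMap (FaithfulSMul.algebraMap_injective ℤ[X] L)

theorem transcendental_algebraMap_X : Transcendental ℤ (algebraMap ℤ[X] L X) :=
  (transcendental_algebraMap_iff (FaithfulSMul.algebraMap_injective ℤ[X] L)).2 (transcendental_X ℤ)

theorem isAlgebraic_of_isAlgebraic_natCast_pow_mul_pow {R : Type*} [CommRing R] [IsDomain R]
    [Algebra R L] {d : ℕ} (hd : 2 ≤ d) {c : L} (h : IsAlgebraic R ((d : L) ^ d * c ^ (d - 1))) :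
    IsAlgebraic R c := by
  have := charZero_of_algebra_polynomial_int L
  have hd0 : (d : L) ^ d ≠ 0 := pow_ne_zero _ (Nat.cast_ne_zero.2 (by omega))
  have hnat : IsAlgebraic R ((d : L) ^ d) := by
    rw [← Nat.cast_pow]
    exact isAlgebraic_natCast _
  refine IsAlgebraic.of_pow (n := d - 1) (by omega) ?_
  have := hnat.inv.mul h
  rwa [inv_mul_cancel_left₀ hd0] at this

theorem isAlgebraic_adjoin_singleton [Algebra.IsAlgebraic ℤ[X] L] {t : L}
    (ht : IsAlgebraic (Algebra.adjoin ℤ {t}) (algebraMap ℤ[X] L X)) :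
    Algebra.IsAlgebraic (Algebra.adjoin ℤ {t}) L := by
  refine ⟨fun x => ?_⟩
  let S := Subalgebra.algebraicClosure (Algebra.adjoin ℤ {t}) L
  have hS : ∀ q : ℤ[X], algebraMap ℤ[X] L q ∈ S := by
    intro q
    induction q using Polynomial.induction_on' with
    | add p q hp hq => rw [map_add]; exact S.add_mem hp hq
    | monomial n a =>
      rw [← C_mul_X_pow_eq_monomial, map_mul, map_pow, eq_intCast C a, map_intCast]
      exact S.mul_mem (intCast_mem S a) (S.pow_mem ht n)
  let φ : ℤ[X] →+* S := (algebraMap ℤ[X] L).codRestrict S hS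
  have hφ : Function.Injective φ := fun p q h =>
    FaithfulSMul.algebraMap_injective ℤ[X] L (congrArg Subtype.val h)
  obtain ⟨p, hp, hpx⟩ := Algebra.IsAlgebraic.isAlgebraic (R := ℤ[X]) x
  have hx : IsAlgebraic S x := by
    refine ⟨p.map φ, (Polynomial.map_ne_zero_iff hφ).2 hp, ?_⟩
    rw [aeval_def, eval₂_map, ← hpx, aeval_def]
    rfl
  exact hx.restrictScalars _

theorem monic_natDegree_of_aeval_eq_coeff_zero_multiplierPoly {d m : ℕ} (hd : 2 ≤ d) (hm : m ≠ 0)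
    {Φ : ℤ[X][X]} (hΦ : Φ.map (algebraMap ℤ[X] L) = exactPeriodPoly L d m)
    (hΦ0 : (Φ.coeff 0).Monic) (hdeg : d * (Φ.coeff 0).natDegree = Φ.natDegree) {p : ℤ[X]}
    (hp : aeval ((d : L) ^ d * algebraMap ℤ[X] L X ^ (d - 1)) p =
      (multiplierPoly L d m).coeff 0) :
    (C ((-1) ^ ((multiplierPoly L d m).natDegree + Φ.natDegree * (d - 1))) * p).Monic ∧
      p.natDegree = (Φ.coeff 0).natDegree := by
  set n := (multiplierPoly L d m).natDegree with hn
  set ε : ℤ := (-1) ^ (n + Φ.natDegree * (d - 1)) with hε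
  have hd1 : 0 < d - 1 := by omega
  have hεε : ε * ε = 1 := by rw [hε, ← mul_pow]; simp
  have hcard : Φ.natDegree = (exactPeriodPoints L d m).card := by
    rw [← natDegree_map_eq_of_injective (FaithfulSMul.algebraMap_injective ℤ[X] L), hΦ,
      exactPeriodPoly, natDegree_prod_of_monic _ _ fun z _ => monic_X_sub_C z]
    simp
  have hprod : algebraMap ℤ[X] L (Φ.coeff 0) =
      (-1) ^ Φ.natDegree * ∏ z ∈ exactPeriodPoints L d m, z := by
    rw [← coeff_map, hΦ, exactPeriodPoly, coeff_zero_eq_eval_zero, eval_prod, hcard,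
      ← Finset.prod_const, ← Finset.prod_mul_distrib]
    simp
  -- Substituting `t = d^d c^(d-1)` into `p` gives an identity in `ℤ[c]`, from which the degree and
  -- leading coefficient of `p` are read off. The sign `(-1)^(deg Φ * (d-1))` in `ε` comes from
  -- `Φ(0) = (-1)^(deg Φ) ∏ z`.
  have hcomp : p.comp (C ((d : ℤ) ^ d) * X ^ (d - 1)) =
      C (ε * (d : ℤ) ^ Φ.natDegree) * Φ.coeff 0 ^ (d - 1) := by
    apply FaithfulSMul.algebraMap_injective ℤ[X] L
    have h1 : algebraMap ℤ[X] L (p.comp (C ((d : ℤ) ^ d) * X ^ (d - 1))) =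
        aeval ((d : L) ^ d * algebraMap ℤ[X] L X ^ (d - 1)) p := by
      have haeval : ∀ r : ℤ[X], algebraMap ℤ[X] L r = aeval (algebraMap ℤ[X] L X) r := fun r => by
        rw [aeval_algebraMap_apply, aeval_X_left_apply]
      rw [haeval, aeval_comp]
      simp
    rw [h1, hp, coeff_zero_multiplierPoly hd hm, Finset.prod_mul_distrib, Finset.prod_const,
      Finset.prod_pow, ← hcard, map_mul, map_pow, hprod, mul_pow, ← pow_mul, hε]
    simp only [map_mul, map_pow, map_neg, map_one, map_natCast]
    have h2 : ((-1 : L) ^ (Φ.natDegree * (d - 1))) * (-1 : L) ^ (Φ.natDegree * (d - 1)) = 1 := by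
      rw [← mul_pow]; simp
    rw [pow_add]
    linear_combination (-((-1 : L) ^ n * (d : L) ^ Φ.natDegree *
      (∏ z ∈ exactPeriodPoints L d m, z) ^ (d - 1))) * h2
  have hdd : (d : ℤ) ^ d ≠ 0 := pow_ne_zero _ (by exact_mod_cast (by omega : d ≠ 0))
  have hε0 : ε ≠ 0 := left_ne_zero_of_mul_eq_one hεε
  have hinner : (C ((d : ℤ) ^ d) * X ^ (d - 1)).natDegree = d - 1 := natDegree_C_mul_X_pow _ _ hdd
  have hN : p.natDegree = (Φ.coeff 0).natDegree := by
    have := congrArg natDegree hcomp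
    rw [natDegree_comp, hinner, natDegree_C_mul (mul_ne_zero hε0 (pow_ne_zero _
      (by exact_mod_cast (by omega : d ≠ 0)))), hΦ0.natDegree_pow, mul_comm] at this
    exact Nat.eq_of_mul_eq_mul_left hd1 this
  refine ⟨?_, hN⟩
  -- The left side has leading coefficient `lc(p) * d^(d deg p)`, and `d * deg p = deg Φ`, so the
  -- powers of `d` cancel and leave `lc(p) = ε`.
  have hl := congrArg leadingCoeff hcomp
  rw [leadingCoeff_comp (by rw [hinner]; omega), leadingCoeff_C_mul_X_pow, leadingCoeff_mul,
    leadingCoeff_C, (hΦ0.pow _).leadingCoeff, mul_one, hN, ← pow_mul, hdeg] at hl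
  have hl' : p.leadingCoeff = ε := mul_right_cancel₀
    (pow_ne_zero _ (by exact_mod_cast (by omega : d ≠ 0))) hl
  rw [Monic, leadingCoeff_mul, leadingCoeff_C, hl', hεε]

variable [IsAlgClosed L]

/-- The coefficients of the multiplier polynomial are polynomials in `t = d ^ d * c ^ (d - 1)`. -/
theorem exists_aeval_eq_coeff_multiplierPoly [Algebra.IsAlgebraic ℤ[X] L] {d m : ℕ} (hd : 2 ≤ d)
    (hm : m ≠ 0) (j : ℕ) :
    ∃ p : ℤ[X], aeval ((d : L) ^ d * algebraMap ℤ[X] L X ^ (d - 1)) p =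
      (multiplierPoly L d m).coeff j := by
  have := charZero_of_algebra_polynomial_int L
  set c := algebraMap ℤ[X] L X with hc
  set t := (d : L) ^ d * c ^ (d - 1) with ht
  have hd1 : d - 1 ≠ 0 := by omega
  have hd0 : (d : L) ^ d ≠ 0 := pow_ne_zero _ (Nat.cast_ne_zero.2 (by omega))
  have htr : Transcendental ℤ t := fun h => transcendental_algebraMap_X (L := L)
    (isAlgebraic_of_isAlgebraic_natCast_pow_mul_pow hd h)
  obtain ⟨μ, hμ⟩ := IsAlgClosed.exists_pow_nat_eq (d : L) (Nat.pos_of_ne_zero hd1)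
  have hs : (μ ^ d * c) ^ (d - 1) = t := by
    rw [mul_pow, ← pow_mul, mul_comm d, pow_mul, hμ]
  refine exists_aeval_eq_of_fixed htr (isAlgebraic_adjoin_singleton
    (isAlgebraic_of_isAlgebraic_natCast_pow_mul_pow hd
      (isAlgebraic_algebraMap (R := Algebra.adjoin ℤ {t})
        ⟨t, Algebra.self_mem_adjoin_singleton ℤ t⟩))) ?_ fun σ hσ => ?_
  · have := coeff_multiplierPoly_mul_pow_mem (L := L) hd hm (b := t) (μ := μ) (ρ := 1)
      (by rw [hμ, mul_one]) (by rw [hμ]; exact natCast_mem _ _)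
      (mem_integralOver_of_pow_mem hd1 (by rw [hs]; exact self_mem_integralOver t)) j
    simpa using this
  · have hσc : σ c ^ (d - 1) = c ^ (d - 1) := by
      rw [ht, map_mul, map_pow, map_pow, map_natCast] at hσ
      exact mul_left_cancel₀ hd0 hσ
    conv_rhs => rw [← map_multiplierPoly hd hm σ hσc, coeff_map]
    rfl

/-- The growth of the multipliers as `c` tends to infinity, in algebraic form: `w = y⁻¹` is a
uniformiser there, and each multiplier has a pole of order at most `m(d-1)` in `w`, while `t` has
one of order `d(d-1)`. -/
theorem mul_natDegree_le_of_aeval_eq_coeff_multiplierPoly {d m : ℕ} (hd : 2 ≤ d)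
    (hm : m ≠ 0) {j : ℕ} {p : ℤ[X]}
    (hp : aeval ((d : L) ^ d * algebraMap ℤ[X] L X ^ (d - 1)) p =
      (multiplierPoly L d m).coeff j) :
    d * p.natDegree ≤ m * ((multiplierPoly L d m).natDegree - j) := by
  have := charZero_of_algebra_polynomial_int L
  set c := algebraMap ℤ[X] L X with hc
  set t := (d : L) ^ d * c ^ (d - 1) with ht
  have hd1 : d - 1 ≠ 0 := by omega
  have hd0 : (d : L) ^ d ≠ 0 := pow_ne_zero _ (Nat.cast_ne_zero.2 (by omega))
  have htr : Transcendental ℤ t := fun h => transcendental_algebraMap_X (L := L)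
    (isAlgebraic_of_isAlgebraic_natCast_pow_mul_pow hd h)
  obtain ⟨μ, hμ⟩ := IsAlgClosed.exists_pow_nat_eq (d : L) (Nat.pos_of_ne_zero hd1)
  have hs : (μ ^ d * c) ^ (d - 1) = t := by
    rw [mul_pow, ← pow_mul, mul_comm d, pow_mul, hμ]
  obtain ⟨y, hy⟩ := IsAlgClosed.exists_pow_nat_eq (μ ^ d * c) (by omega : 0 < d)
  have hyt : y ^ (d * (d - 1)) = t := by rw [pow_mul, hy, hs]
  have hw : Transcendental ℤ y⁻¹ := fun h => htr (by
    have := h.inv.pow (d * (d - 1))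
    rwa [inv_inv, hyt] at this)
  have hy0 : y ≠ 0 := by
    rintro rfl
    exact hw (by rw [inv_zero]; exact isAlgebraic_zero)
  have hself := self_mem_integralOver y⁻¹
  -- With scaling factor `μ * y⁻¹`, the constant term of the recursion becomes `μ^d c / y^d = 1`,
  -- and `(μ * y⁻¹)^(d-1) = d * y⁻¹^(d-1)` dictates `ρ`.
  have h := coeff_multiplierPoly_mul_pow_mem (L := L) hd hm (b := y⁻¹) (μ := μ * y⁻¹)
    (ρ := y⁻¹ ^ (d - 1)) (by rw [mul_pow, hμ])
    (by rw [mul_pow, hμ]; exact Subring.mul_mem _ (natCast_mem _ _) (Subring.pow_mem _ hself _))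
    (by
      rw [mul_pow, mul_right_comm, ← hc, ← hy, ← mul_pow, mul_inv_cancel₀ hy0, one_pow]
      exact Subring.one_mem _) j
  rw [← hp, ← pow_mul, ← pow_mul] at h
  have hle := mul_natDegree_le_of_mul_pow_mem_integralOver hw (e := d * (d - 1))
    (mul_ne_zero (by omega) hd1)
    (by rw [← hyt, ← mul_pow, mul_inv_cancel₀ hy0, one_pow]) p h
  refine Nat.le_of_mul_le_mul_left (c := d - 1) ?_ (Nat.pos_of_ne_zero hd1)
  calc (d - 1) * (d * p.natDegree) = d * (d - 1) * p.natDegree := by ring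
    _ ≤ _ := hle
    _ = _ := by ring

theorem exists_substOuter_eq_multiplierPoly [Algebra.IsAlgebraic ℤ[X] L] {d m : ℕ} (hd : 2 ≤ d)
    (hm : m ≠ 0) {Φ : ℤ[X][X]} (hΦ : Φ.map (algebraMap ℤ[X] L) = exactPeriodPoly L d m)
    (hΦ0 : (Φ.coeff 0).Monic) (hdeg : d * (Φ.coeff 0).natDegree = Φ.natDegree)
    (hcard : m * (multiplierPoly L d m).natDegree = Φ.natDegree) :
    ∃ Ψ : ℤ[X][X], multiplierPoly L d m =
        substOuter Ψ (algebraMap ℤ[X] L ((d : ℤ[X]) ^ d * X ^ (d - 1))) ∧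
      (C (C ((-1) ^ ((multiplierPoly L d m).natDegree + Φ.natDegree * (d - 1)))) * Ψ).Monic := by
  choose ψ hψ using exists_aeval_eq_coeff_multiplierPoly (L := L) hd hm
  set n := (multiplierPoly L d m).natDegree with hn
  obtain ⟨hmonic, hdeg0⟩ := monic_natDegree_of_aeval_eq_coeff_zero_multiplierPoly hd hm hΦ hΦ0
    hdeg (hψ 0)
  rw [← hn] at hmonic
  set ε : ℤ := (-1) ^ (n + Φ.natDegree * (d - 1)) with hε
  have hε0 : ε ≠ 0 := pow_ne_zero _ (by norm_num)
  -- `ψ j` is moved to the outer variable `t` by mapping its coefficients through `C`, while `x^j`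
  -- sits in the inner variable.
  refine ⟨∑ j ∈ Finset.range (n + 1), (ψ j).map C * C (X ^ j), ?_, ?_⟩
  · rw [substOuter, eval₂_finsetSum, as_sum_range_C_mul_X_pow (multiplierPoly L d m), ← hn]
    refine Finset.sum_congr rfl fun j _ => ?_
    rw [eval₂_mul, eval₂_C, eval₂_map, ← hψ j]
    congr 1
    · rw [aeval_def, hom_eval₂,
        RingHom.ext_int (C.comp (algebraMap ℤ L)) ((mapRingHom (Int.castRingHom L)).comp C)]
      simp
    · simp
  · rw [Finset.sum_range_succ', pow_zero, C_1, mul_one, mul_add, add_comm]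
    have h0 : (C (C ε) * (ψ 0).map C : ℤ[X][X]) = (C ε * ψ 0).map C := by
      rw [Polynomial.map_mul, map_C]
    rw [h0]
    refine (hmonic.map C).add_of_left ?_
    rw [degree_eq_natDegree (hmonic.map C).ne_zero, hmonic.natDegree_map, natDegree_C_mul hε0, hdeg0,
      ← natDegree_C_mul (p := Φ.coeff 0) hε0]
    rw [natDegree_C_mul hε0, Finset.mul_sum]
    refine (degree_sum_le _ _).trans_lt ((Finset.sup_lt_iff (WithBot.bot_lt_coe _)).2 fun j hj => ?_)
    refine (degree_le_natDegree).trans_lt (Nat.cast_lt.2 ?_)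
    refine lt_of_le_of_lt ((natDegree_C_mul_le _ _).trans ((natDegree_mul_C_le _ _).trans
      natDegree_map_le)) ?_
    have hle := mul_natDegree_le_of_aeval_eq_coeff_multiplierPoly hd hm (hψ (j + 1))
    rw [← hn] at hle
    rw [Finset.mem_range] at hj
    -- Multiplied by `d`, the comparison is `d deg ψ_(j+1) ≤ m(n-j-1) < mn = d deg ψ_0`, so the
    -- terms with positive power of `x` have strictly smaller `t`-degree.
    refine Nat.lt_of_mul_lt_mul_left (a := d) (hle.trans_lt ?_)
    rw [hdeg, ← hcard]
    exact Nat.mul_lt_mul_of_pos_left (by omega) (Nat.pos_of_ne_zero hm)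

end Parameter

end Dynatomic

/-! ### The main theorem -/

open Dynatomic

theorem theorem1p2 (d : ℕ) (hd : 2 ≤ d) (m : ℕ) (hm : 1 ≤ m) :
    (∃! δ : (Dynatomic.GeomField ℤ[X])[X],
      Dynatomic.IsMultiplierPolynomial (Dynatomic.unicritical d) m δ) ∧
    (m : ℤ) ∣ Dynatomic.formalDegree d m ∧
    ∀ δ : (Dynatomic.GeomField ℤ[X])[X],
      Dynatomic.IsMultiplierPolynomial (Dynatomic.unicritical d) m δ →
      ∃ Ψ : ℤ[X][X],
        δ = Dynatomic.substOuter Ψ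
          (algebraMap ℤ[X] (Dynatomic.GeomField ℤ[X]) ((d : ℤ[X]) ^ d * X ^ (d - 1))) ∧
        ((-1 : ℤˣ) ^ (Dynatomic.formalDegree d m / (m : ℤ) +
            Dynatomic.formalDegree d m * ((d : ℤ) - 1)) • Ψ).Monic := by
  have hm0 : m ≠ 0 := by omega
  have halg : Algebra.IsAlgebraic ℤ[X] (GeomField ℤ[X]) :=
    (IsFractionRing.comap_isAlgebraic_iff (K := FractionRing ℤ[X])).2 inferInstance
  have hfaith : FaithfulSMul ℤ[X] (GeomField ℤ[X]) := by
    rw [faithfulSMul_iff_algebraMap_injective,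
      IsScalarTower.algebraMap_eq ℤ[X] (FractionRing ℤ[X]) (GeomField ℤ[X])]
    exact (algebraMap (FractionRing ℤ[X]) (GeomField ℤ[X])).injective.comp (IsFractionRing.injective ℤ[X] (FractionRing ℤ[X]))
  obtain ⟨Φ, hdyn, hmap, hfd, hΦ0, hdeg⟩ := exists_dynatomicPolynomial (GeomField ℤ[X]) hd hm0
  have hcard : m * (multiplierPoly (GeomField ℤ[X]) d m).natDegree = Φ.natDegree := by
    rw [mul_natDegree_multiplierPoly hd hm0,
      ← natDegree_map_eq_of_injective (FaithfulSMul.algebraMap_injective ℤ[X] (GeomField ℤ[X])),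
      hmap, exactPeriodPoly, natDegree_prod_of_monic _ _ fun z _ => monic_X_sub_C z]
    simp
  have hiff : ∀ δ : (GeomField ℤ[X])[X], IsMultiplierPolynomial (unicritical d) m δ ↔
      δ = multiplierPoly (GeomField ℤ[X]) d m := by
    intro δ
    rw [isMultiplierPolynomial_iff hdyn, prod_aroots_eq_multiplierPoly_pow hd hm0 hmap]
    constructor
    · exact fun h => monic_eq_of_pow_eq h.1 (monic_multiplierPoly d m) hm0 h.2
    · rintro rfl
      exact ⟨monic_multiplierPoly d m, rfl⟩
  have hfd' : formalDegree d m = m * ((multiplierPoly (GeomField ℤ[X]) d m).natDegree : ℤ) := by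
    rw [← hfd, ← hcard, Nat.cast_mul]
  refine ⟨⟨_, (hiff _).2 rfl, fun δ hδ => (hiff δ).1 hδ⟩, ⟨_, hfd'⟩, fun δ hδ => ?_⟩
  rw [(hiff δ).1 hδ]
  obtain ⟨Ψ, hΨ, hmonic⟩ := exists_substOuter_eq_multiplierPoly hd hm0 hmap hΦ0 hdeg hcard
  refine ⟨Ψ, hΨ, ?_⟩
  have hquot : formalDegree d m / (m : ℤ) = (multiplierPoly (GeomField ℤ[X]) d m).natDegree := by
    rw [hfd', Int.mul_ediv_cancel_left _ (by exact_mod_cast hm0)]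
  -- The integer exponent is the cast of a natural number, so the power of the unit `-1` is an
  -- ordinary sign.
  have hexp : formalDegree d m / (m : ℤ) + formalDegree d m * ((d : ℤ) - 1) =
      (((multiplierPoly (GeomField ℤ[X]) d m).natDegree + Φ.natDegree * (d - 1) : ℕ) : ℤ) := by
    rw [hquot, ← hfd]
    push_cast [Nat.cast_sub (by omega : 1 ≤ d)]
    ring
  rw [hexp, zpow_natCast, Units.smul_def, zsmul_eq_mul]
  convert hmonic using 2
  simp
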